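/- Let $\mathbb{S}^d\subset\mathbb{R}^{d+1}$ be the unit sphere with its geodesic distance, and let $X\subset\mathbb{S}^d$ be a finite set such that no $d+2$ points of $X$ lie on a common geodesic sphere. For a finite $Y\subset \mathbb{S}^d$, the Delaunay complex $\mathrm{Del}(Y)$ is the abstract simplicial complex whose maximal simplices are the $(d+1)$-point subsets of $Y$ that lie on a geodesic sphere $\{x : d_{\mathbb{S}^d}(x,c)=r\}$, $c\in\mathbb{S}^d$, whose open ball $\{x : d_{\mathbb{S}^d}(x,c)<r\}$ contains no point of $Y$. Let $L$ be a finite simplicial complex, let $g\colon \mathrm{Del}(X)\to L$ be a simplicial map (a map on vertices that sends simplices to simplices), and let $v\in X$ satisfy the simplex condition: the image under $g$ of the vertex set of the closed star of $v$ in $\mathrm{Del}(X)$ (that is, of all vertices that lie in a common simplex with $v$) is a simplex of $L$. Let $g'$ be the restriction of $g$ to $X\setminus\{v\}$. Then: 1. $g'$ is a simplicial map $\mathrm{Del}(X\setminus\{v\})\to L$. 2. Suppose moreover that the origin lies in the interior of the convex hull of $X\setminus\{v\}$. Then the radial projections $r\colon\mathbb{S}^d\to|\mathrm{Del}(X)|$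 and $r'\colon\mathbb{S}^d\to|\mathrm{Del}(X\setminus\{v\})|$, which send $x$ to the point of the complex on the open ray from the origin through $x$, are homeomorphisms, and with respect to them $g$ and $g'$ are contiguous: for every $x\in\mathbb{S}^d$, if $\sigma\in\mathrm{Del}(X)$ and $\sigma'\in\mathrm{Del}(X\setminus\{v\})$ are the simplices whose interiors contain $r(x)$ and $r'(x)$, then $g(\sigma)\cup g'(\sigma')$ is a simplex of $L$. Moreover, the maps $|g|\circ r$ and $|g'|\circ r'\colon\mathbb{S}^d\to|L|$ are homotopic. -/

import Mathlib

open Set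

/-! ### Abstract simplicial complexes, simplicial maps, stars -/

section SimplicialComplexes

variable {V W : Type*}

/-- The set `S` of vertices is (the vertex set of) a simplex of `K`. -/
def IsSimplexOf (K : PreAbstractSimplicialComplex V) (S : Set V) : Prop :=
  ∃ σ ∈ K.faces, (σ : Set V) = S

/-- The vertex map `g` sends every simplex of `K` onto a simplex of `L`.  Only the values of `g` at
vertices of `K` matter. -/
def IsSimplicialMap (K : PreAbstractSimplicialComplex V) (L : PreAbstractSimplicialComplex W)
    (g : V → W) : Prop :=
  ∀ σ ∈ K.faces, IsSimplexOf L (g '' (σ : Set V))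

/-- The vertex set (0-skeleton) of a simplicial complex. -/
def vertexSet (K : PreAbstractSimplicialComplex V) : Set V :=
  {v | {v} ∈ K.faces}

/-- The open star of a vertex: all simplices that contain it. -/
def openStar (K : PreAbstractSimplicialComplex V) (v : V) : Set (Finset V) :=
  {σ | σ ∈ K.faces ∧ v ∈ σ}

/-- The closed star of a vertex: all nonempty faces of the simplices that contain the vertex. -/
def closedStar (K : PreAbstractSimplicialComplex V) (v : V) : PreAbstractSimplicialComplex V where
  faces := {τ | τ.Nonempty ∧ ∃ σ ∈ openStar K v, τ ⊆ σ}
  isRelLowerSet_faces := by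
    rintro τ ⟨hτ, σ, hσ, hτσ⟩
    exact ⟨hτ, fun ρ hρ hne => ⟨hne, σ, hσ, Finset.Subset.trans hρ hτσ⟩⟩

/-- The closed star is the smallest simplicial complex that contains the open star. -/
theorem closedStar_isLeast (K : PreAbstractSimplicialComplex V) (v : V) :
    IsLeast {M : PreAbstractSimplicialComplex V | openStar K v ⊆ M.faces} (closedStar K v) := by
  constructor
  · intro σ hσ
    exact ⟨⟨v, hσ.2⟩, σ, hσ, Finset.Subset.refl σ⟩
  · intro M hM τ hτ
    obtain ⟨hne, σ, hσ, hτσ⟩ := hτ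
    exact (M.isRelLowerSet_faces (hM hσ)).2 hτσ hne

/-- The simplex condition at `v`: the vertices of the closed star of `v` are mapped by `g` onto
the vertex set of a simplex of `L`. -/
def SimplexCondition (K : PreAbstractSimplicialComplex V) (L : PreAbstractSimplicialComplex W)
    (g : V → W) (v : V) : Prop :=
  IsSimplexOf L (g '' vertexSet (closedStar K v))

/-! ### Geometric realizations -/

/-- The geometric realization of a simplicial complex, described by barycentric coordinates:
nonnegative weights on the vertices, of sum one, whose support is a simplex.  As a subspace of
`V → ℝ` it carries the usual topology of the realization when the complex is finite, which is the
only case in which it is used. -/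
def realization (K : PreAbstractSimplicialComplex V) : Set (V → ℝ) :=
  {a | (∀ v, 0 ≤ a v) ∧ IsSimplexOf K (Function.support a) ∧ ∑ᶠ v, a v = 1}

/-- The image of a weight function under a vertex map: the point `∑ a v • v` is sent to
`∑ a v • g v`. -/
noncomputable def pushWeights (g : V → W) (a : V → ℝ) : W → ℝ :=
  fun w => ∑ᶠ v ∈ {v | g v = w}, a v

theorem pushWeights_eq_sum [DecidableEq W] (g : V → W) (a : V → ℝ) (σ : Finset V)
    (hσ : Function.support a ⊆ σ) (w : W) :
    pushWeights g a w = ∑ v ∈ σ with g v = w, a v := by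
  unfold pushWeights
  apply finsum_mem_eq_sum_of_inter_support_eq
  ext v
  constructor
  · rintro ⟨h1, h2⟩
    exact ⟨by simpa using ⟨hσ h2, h1⟩, h2⟩
  · rintro ⟨h1, h2⟩
    have h3 : v ∈ σ ∧ g v = w := by simpa using h1
    exact ⟨h3.2, h2⟩

theorem support_pushWeights (g : V → W) (a : V → ℝ) (ha : ∀ v, 0 ≤ a v)
    (hfin : (Function.support a).Finite) :
    Function.support (pushWeights g a) = g '' Function.support a := by
  classical
  have hσ : Function.support a ⊆ (hfin.toFinset : Set V) := by simp
  ext w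
  rw [Function.mem_support, pushWeights_eq_sum g a hfin.toFinset hσ w, Ne,
    Finset.sum_eq_zero_iff_of_nonneg (fun v _ => ha v)]
  push Not
  constructor
  · rintro ⟨v, hv, hne⟩
    exact ⟨v, hne, (Finset.mem_filter.1 hv).2⟩
  · rintro ⟨v, hv, rfl⟩
    exact ⟨v, by simpa using hv, hv⟩

theorem pushWeights_mem_realization {K : PreAbstractSimplicialComplex V}
    {L : PreAbstractSimplicialComplex W} {g : V → W} (hg : IsSimplicialMap K L g)
    {a : V → ℝ} (ha : a ∈ realization K) : pushWeights g a ∈ realization L := by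
  classical
  obtain ⟨h0, ⟨σ, hσ, hsupp⟩, hsum⟩ := ha
  have hfin : (Function.support a).Finite := hsupp ▸ σ.finite_toSet
  have hsub : Function.support a ⊆ (σ : Set V) := hsupp.ge
  have hps := support_pushWeights g a h0 hfin
  refine ⟨fun w => ?_, ?_, ?_⟩
  · rw [pushWeights_eq_sum g a σ hsub w]
    exact Finset.sum_nonneg fun v _ => h0 v
  · rw [hps, ← hsupp]
    exact hg σ hσ
  · have hsub' : Function.support (pushWeights g a) ⊆ (σ.image g : Finset W) := by
      rw [hps, ← hsupp, Finset.coe_image]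
    rw [finsum_eq_sum_of_support_subset _ hsub']
    rw [finsum_eq_sum_of_support_subset _ hsub] at hsum
    have hmaps : ∀ v ∈ σ, g v ∈ σ.image g := fun v h => Finset.mem_image_of_mem g h
    rw [← hsum, ← Finset.sum_fiberwise_of_maps_to hmaps]
    exact Finset.sum_congr rfl fun w _ => pushWeights_eq_sum g a σ hsub w

/-- The geometric realization `|K| → |L|` of a simplicial map, for a finite complex `K`. -/
noncomputable def realizationMap {K : PreAbstractSimplicialComplex V}
    {L : PreAbstractSimplicialComplex W} {g : V → W} (hK : K.faces.Finite)
    (hg : IsSimplicialMap K L g) : C(realization K, realization L) where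
  toFun a := ⟨pushWeights g a.1, pushWeights_mem_realization hg a.2⟩
  continuous_toFun := by
    classical
    refine Continuous.subtype_mk (continuous_pi fun w => ?_) _
    have hsub : ∀ a : realization K,
        Function.support a.1 ⊆ (hK.toFinset.biUnion id : Finset V) := by
      intro a v hva
      obtain ⟨σ, hσ, hsupp⟩ := a.2.2.1
      have hvσ : v ∈ (σ : Set V) := hsupp.ge hva
      simp only [Finset.coe_biUnion, Set.mem_iUnion]
      exact ⟨σ, by simpa using hσ, hvσ⟩
    have heq : (fun a : realization K => pushWeights g a.1 w)
        = fun a => ∑ v ∈ hK.toFinset.biUnion id with g v = w, a.1 v :=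
      funext fun a => pushWeights_eq_sum g a.1 _ (hsub a) w
    rw [heq]
    exact continuous_finsetSum _ fun v _ => (continuous_apply v).comp continuous_subtype_val

end SimplicialComplexes

/-! ### Delaunay complexes on the sphere -/

section Delaunay

/-- The ambient Euclidean space of the `d`-dimensional sphere. -/
abbrev Ambient (d : ℕ) : Type := EuclideanSpace ℝ (Fin (d + 1))

/-- The unit sphere of dimension `d`. -/
abbrev UnitSphere (d : ℕ) : Set (Ambient d) := Metric.sphere (0 : Ambient d) 1

/-- Geodesic distance on the unit sphere: the angle between the two unit vectors. -/
noncomputable def geodesicDist {d : ℕ} (x y : Ambient d) : ℝ := InnerProductGeometry.angle x y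

/-- All points of `S` lie on one geodesic sphere of the unit sphere. -/
def LieOnGeodesicSphere {d : ℕ} (S : Set (Ambient d)) : Prop :=
  ∃ c ∈ UnitSphere d, ∃ r : ℝ, ∀ x ∈ S, geodesicDist x c = r

/-- No `d + 2` points of `X` lie on one geodesic sphere. -/
def IsGeneric {d : ℕ} (X : Set (Ambient d)) : Prop :=
  ∀ S : Finset (Ambient d), (S : Set (Ambient d)) ⊆ X → S.card = d + 2 →
    ¬ LieOnGeodesicSphere (S : Set (Ambient d))

/-- The set `τ` has a circumscribing geodesic ball whose interior contains no point of `X`. -/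
def HasEmptyCircle {d : ℕ} (X : Set (Ambient d)) (τ : Finset (Ambient d)) : Prop :=
  ∃ c ∈ UnitSphere d, ∃ r : ℝ, (∀ x ∈ τ, geodesicDist x c = r) ∧ ∀ x ∈ X, r ≤ geodesicDist x c

/-- The Delaunay complex of `X`: its maximal simplices are the subsets of `d + 1` points of `X`
with the empty circle property. -/
def delaunay {d : ℕ} (X : Set (Ambient d)) : PreAbstractSimplicialComplex (Ambient d) where
  faces := {σ | σ.Nonempty ∧ ∃ τ : Finset (Ambient d),
    (τ : Set (Ambient d)) ⊆ X ∧ τ.card = d + 1 ∧ HasEmptyCircle X τ ∧ σ ⊆ τ}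
  isRelLowerSet_faces := by
    rintro σ ⟨hσ, τ, h1, h2, h3, h4⟩
    exact ⟨hσ, fun ρ hρ hne => ⟨hne, τ, h1, h2, h3, Finset.Subset.trans hρ h4⟩⟩

theorem delaunay_finite {d : ℕ} {X : Set (Ambient d)} (hX : X.Finite) :
    (delaunay X).faces.Finite := by
  refine Set.Finite.subset (hX.toFinset.powerset.finite_toSet) ?_
  rintro σ ⟨-, τ, h1, -, -, h4⟩
  simp only [Finset.coe_powerset, Set.mem_preimage, Set.mem_powerset_iff, Set.Finite.coe_toFinset]
  exact fun x hx => h1 (h4 hx)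

/-- The point `∑ a x • x` of Euclidean space represented by the weights `a`. -/
noncomputable def weightedPoint {d : ℕ} (a : Ambient d → ℝ) : Ambient d := ∑ᶠ x, a x • x

/-- `r` is the radial projection of the unit sphere onto the realization of `K` (a complex whose
vertices are points of Euclidean space): it sends `x` to a point on the open ray through `x`. -/
def IsRadialProjection {d : ℕ} (K : PreAbstractSimplicialComplex (Ambient d))
    (r : UnitSphere d → realization K) : Prop :=
  ∀ x : UnitSphere d, ∃ t : ℝ, 0 < t ∧ weightedPoint (r x).1 = t • (x : Ambient d)

end Delaunay

section Contiguity

variable {Z V V' W : Type*}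

/-- Contiguity of two vertex maps `g`, `g'` into `L` defined on complexes `K`, `K'` that
triangulate the same space `Z` through `r`, `r'`: if `σ` and `σ'` are the simplices of `K` and `K'`
whose interiors contain the images of a point `z`, then `g(σ) ∪ g'(σ')` is a simplex of `L`.
For `K = K'` and `r = r'` a homeomorphism, this says that `g(σ) ∪ g'(σ)` is a simplex of `L` for
every simplex `σ` of `K`. -/
def AreContiguous {K : PreAbstractSimplicialComplex V} {K' : PreAbstractSimplicialComplex V'}
    (L : PreAbstractSimplicialComplex W) (r : Z → realization K) (r' : Z → realization K')
    (g : V → W) (g' : V' → W) : Prop :=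
  ∀ z : Z, IsSimplexOf L
    (g '' Function.support (r z : V → ℝ) ∪ g' '' Function.support (r' z : V' → ℝ))

/-- On a common complex, contiguity is the usual condition on its simplices. -/
theorem areContiguous_iff {K : PreAbstractSimplicialComplex V}
    (L : PreAbstractSimplicialComplex W) (r : Z → realization K) (hr : Function.Surjective r)
    (g g' : V → W) :
    AreContiguous L r r g g' ↔
      ∀ σ ∈ K.faces, IsSimplexOf L (g '' (σ : Set V) ∪ g' '' (σ : Set V)) := by
  classical
  constructor
  · intro h σ hσ
    have hne : σ.Nonempty := (K.isRelLowerSet_faces hσ).1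
    have hpos : (0 : ℝ) < σ.card := by exact_mod_cast hne.card_pos
    have hs : Function.support (fun v => if v ∈ σ then (σ.card : ℝ)⁻¹ else 0) = (σ : Set V) := by
      ext v
      by_cases hv : v ∈ σ <;> simp [hv, hne.ne_empty]
    have hmem : (fun v => if v ∈ σ then (σ.card : ℝ)⁻¹ else 0) ∈ realization K := by
      refine ⟨fun v => ?_, ⟨σ, hσ, hs.symm⟩, ?_⟩
      · dsimp only
        split_ifs <;> positivity
      · rw [finsum_eq_sum_of_support_subset _ hs.le, Finset.sum_ite_mem]
        simp [hpos.ne']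
    obtain ⟨z, hz⟩ := hr ⟨_, hmem⟩
    have := h z
    rwa [hz, hs] at this
  · intro h z
    obtain ⟨σ, hσ, hs⟩ := (r z).2.2.1
    rw [← hs]
    exact h σ hσ

end Contiguity

/-! A geodesic ball is cut out of the sphere by a half-space, so the empty circle property says that
a set lies on a supporting hyperplane of X (`hasEmptyCircle_iff`). Conversely, when a generic X has
at least d + 2 points, the contact points of any supporting hyperplane form a Delaunay simplex
(`touching_mem_delaunay`).

Let H support X \ {v} along a simplex σ of its Delaunay complex. If v is not beyond H, then H
supports X and σ is already in Del(X). If v is beyond H, fix w in σ: since w is the strict maximum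
of ⟨w, ·⟩ on the sphere, H can be tilted towards w until it touches X exactly in v and w. So vw is
an edge (`mem_closedStar_of_visible`), all of σ lies in the closed star of v, and the simplex
condition applies. In dimension 0 this is replaced by a direct argument.

If the origin is interior to the hull, r(x) is the last point of the ray through x in the hull of X,
and r'(x) likewise for X \ {v}. Either the two points coincide, and then so do their barycentric
coordinates, or r'(x) comes strictly first. In the latter case v is a vertex of the simplex carrying
r(x) and lies beyond a supporting hyperplane through r'(x), so both carriers lie in the closed star
of v. The homotopy is the straight line inside the common simplex. -/

/-! ### Delaunay simplices as contact sets of supporting hyperplanes -/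

section SupportingHyperplanes

variable {d : ℕ}

/-- At most `d` vectors of a `(d + 1)`-dimensional space have a common nonzero orthogonal vector. -/
theorem exists_ne_zero_inner_eq_zero (S : Finset (Ambient d)) (hS : S.card ≤ d) :
    ∃ c : Ambient d, c ≠ 0 ∧ ∀ x ∈ S, inner ℝ c x = 0 := by
  have hlt : Module.finrank ℝ (Submodule.span ℝ (S : Set (Ambient d))) < d + 1 :=
    lt_of_le_of_lt (finrank_span_finset_le_card S) (by omega)
  have hadd := (Submodule.span ℝ (S : Set (Ambient d))).finrank_add_finrank_orthogonal
  rw [finrank_euclideanSpace_fin] at hadd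
  have hpos : 0 < Module.finrank ℝ (Submodule.span ℝ (S : Set (Ambient d)))ᗮ := by omega
  have : Nontrivial (Submodule.span ℝ (S : Set (Ambient d)))ᗮ := Module.finrank_pos_iff.1 hpos
  obtain ⟨c, hc⟩ := exists_ne (0 : (Submodule.span ℝ (S : Set (Ambient d)))ᗮ)
  refine ⟨c, fun h => hc (Subtype.ext h), fun x hx => ?_⟩
  exact (Submodule.mem_orthogonal' _ _).1 c.2 x (Submodule.subset_span hx)

/-- At most `d + 1` points of a `(d + 1)`-dimensional space lie on a hyperplane. -/
theorem exists_hyperplane (S : Finset (Ambient d)) (hS : S.card ≤ d + 1) :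
    ∃ c : Ambient d, c ≠ 0 ∧ ∃ h : ℝ, ∀ x ∈ S, inner ℝ c x = h := by
  classical
  rcases S.eq_empty_or_nonempty with rfl | ⟨x₀, hx₀⟩
  · obtain ⟨c, hc⟩ := exists_ne (0 : Ambient d)
    exact ⟨c, hc, 0, by simp⟩
  · obtain ⟨c, hc, h⟩ := exists_ne_zero_inner_eq_zero ((S.erase x₀).image fun x => x - x₀)
      (Finset.card_image_le.trans (by rw [Finset.card_erase_of_mem hx₀]; omega))
    refine ⟨c, hc, inner ℝ c x₀, fun x hx => ?_⟩
    by_cases hxx : x = x₀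
    · rw [hxx]
    · have := h _ (Finset.mem_image_of_mem _ (Finset.mem_erase.2 ⟨hxx, hx⟩))
      rw [inner_sub_right] at this
      linarith

/-- At most `d` points lie on a hyperplane orthogonal to a given one. -/
theorem exists_hyperplane_orthogonal (S : Finset (Ambient d)) (hne : S.Nonempty)
    (hS : S.card ≤ d) (c : Ambient d) :
    ∃ c' : Ambient d, c' ≠ 0 ∧ inner ℝ c' c = 0 ∧ ∃ h : ℝ, ∀ x ∈ S, inner ℝ c' x = h := by
  classical
  obtain ⟨x₀, hx₀⟩ := hne
  have hpos := Finset.card_pos.2 ⟨x₀, hx₀⟩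
  -- The at most d - 1 differences from x₀, together with c, are still at most d vectors.
  obtain ⟨c', hc, h⟩ := exists_ne_zero_inner_eq_zero
    (insert c ((S.erase x₀).image fun x => x - x₀))
    ((Finset.card_insert_le _ _).trans (by
      have := (Finset.card_image_le (s := S.erase x₀) (f := fun x => x - x₀))
      rw [Finset.card_erase_of_mem hx₀] at this
      omega))
  refine ⟨c', hc, h _ (Finset.mem_insert_self _ _), inner ℝ c' x₀, fun x hx => ?_⟩
  by_cases hxx : x = x₀
  · rw [hxx]
  · have := h _ (Finset.mem_insert_of_mem
      (Finset.mem_image_of_mem _ (Finset.mem_erase.2 ⟨hxx, hx⟩)))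
    rw [inner_sub_right] at this
    linarith

/-- The geodesic distance to the center of a hyperplane section depends only on the height. -/
theorem geodesicDist_smul_eq_arccos {x c : Ambient d} (hx : x ∈ UnitSphere d) (hc : c ≠ 0) :
    geodesicDist x (‖c‖⁻¹ • c) = Real.arccos (inner ℝ c x / ‖c‖) := by
  have hx1 : ‖x‖ = 1 := by simpa using hx
  rw [geodesicDist, InnerProductGeometry.angle_smul_right_of_pos _ _
    (inv_pos.2 (norm_pos_iff.2 hc)), InnerProductGeometry.angle, hx1, one_mul, real_inner_comm]

theorem inner_eq_cos_geodesicDist {x c : Ambient d} (hx : x ∈ UnitSphere d)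
    (hc : c ∈ UnitSphere d) : inner ℝ c x = Real.cos (geodesicDist x c) := by
  have hx1 : ‖x‖ = 1 := by simpa using hx
  have hc1 : ‖c‖ = 1 := by simpa using hc
  rw [geodesicDist, InnerProductGeometry.cos_angle, hx1, hc1, real_inner_comm]
  simp

theorem inv_norm_smul_mem_unitSphere {c : Ambient d} (hc : c ≠ 0) :
    ‖c‖⁻¹ • c ∈ UnitSphere d := by
  rw [mem_sphere_zero_iff_norm, norm_smul, norm_inv, norm_norm,
    inv_mul_cancel₀ (norm_ne_zero_iff.2 hc)]

/-- The points of the sphere at height h over c lie on the geodesic sphere about c / ‖c‖ of radius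
arccos (h / ‖c‖). This is the only form in which genericity is used. -/
theorem IsGeneric.not_hyperplane {X : Set (Ambient d)} (hX : IsGeneric X)
    (hXS : X ⊆ UnitSphere d) {S : Finset (Ambient d)} (hS : (S : Set (Ambient d)) ⊆ X)
    (hcard : d + 2 ≤ S.card) {c : Ambient d} (hc : c ≠ 0) (h : ℝ) :
    ¬ ∀ x ∈ S, inner ℝ c x = h := by
  intro hall
  obtain ⟨T, hTS, hT⟩ := Finset.exists_subset_card_eq hcard
  refine hX T (fun x hx => hS (hTS hx)) hT
    ⟨_, inv_norm_smul_mem_unitSphere hc, Real.arccos (h / ‖c‖), fun x hx => ?_⟩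
  rw [geodesicDist_smul_eq_arccos (hXS (hS (hTS hx))) hc, hall x (hTS hx)]

theorem IsGeneric.mono {X Y : Set (Ambient d)} (hX : IsGeneric X) (hYX : Y ⊆ X) : IsGeneric Y :=
  fun S hS => hX S (hS.trans hYX)

/-- The empty circle property says that `τ` lies on a supporting hyperplane. -/
theorem hasEmptyCircle_iff {X : Set (Ambient d)} (hXS : X ⊆ UnitSphere d)
    {τ : Finset (Ambient d)} (hτX : (τ : Set (Ambient d)) ⊆ X) (hτ : τ.Nonempty) :
    HasEmptyCircle X τ ↔ ∃ c : Ambient d, c ≠ 0 ∧ ∃ h : ℝ,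
      (∀ x ∈ τ, inner ℝ c x = h) ∧ ∀ x ∈ X, inner ℝ c x ≤ h := by
  constructor
  · rintro ⟨c, hc, r, h1, h2⟩
    refine ⟨c, fun h0 => ?_, Real.cos r, fun x hx => ?_, fun x hx => ?_⟩
    · simp [h0] at hc
    · rw [inner_eq_cos_geodesicDist (hXS (hτX hx)) hc, h1 x hx]
    · rw [inner_eq_cos_geodesicDist (hXS hx) hc]
      obtain ⟨y, hy⟩ := hτ
      refine Real.cos_le_cos_of_nonneg_of_le_pi ?_ (InnerProductGeometry.angle_le_pi _ _) (h2 x hx)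
      -- The radius r is an arbitrary real; it is nonnegative because it is the distance of some
      -- point of τ.
      rw [← h1 y hy]
      exact InnerProductGeometry.angle_nonneg _ _
  · rintro ⟨c, hc, h, h1, h2⟩
    refine ⟨_, inv_norm_smul_mem_unitSphere hc, Real.arccos (h / ‖c‖), fun x hx => ?_,
      fun x hx => ?_⟩
    · rw [geodesicDist_smul_eq_arccos (hXS (hτX hx)) hc, h1 x hx]
    · rw [geodesicDist_smul_eq_arccos (hXS hx) hc]
      exact Real.arccos_le_arccos (by gcongr; exact h2 x hx)

theorem mem_delaunay_iff {X : Set (Ambient d)} (hXS : X ⊆ UnitSphere d) {σ : Finset (Ambient d)} :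
    σ ∈ (delaunay X).faces ↔ σ.Nonempty ∧ ∃ τ : Finset (Ambient d),
      (τ : Set (Ambient d)) ⊆ X ∧ τ.card = d + 1 ∧ σ ⊆ τ ∧ ∃ c : Ambient d, c ≠ 0 ∧ ∃ h : ℝ,
        (∀ x ∈ τ, inner ℝ c x = h) ∧ ∀ x ∈ X, inner ℝ c x ≤ h := by
  refine and_congr_right fun hσ => exists_congr fun τ => ?_
  constructor
  · rintro ⟨h1, h2, h3, h4⟩
    exact ⟨h1, h2, h4, (hasEmptyCircle_iff hXS h1 (hσ.mono h4)).1 h3⟩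
  · rintro ⟨h1, h2, h4, h3⟩
    exact ⟨h1, h2, (hasEmptyCircle_iff hXS h1 (hσ.mono h4)).2 h3, h4⟩

open Classical in
/-- A supporting hyperplane that touches `X` in fewer than `d + 1` points can be tilted, keeping
the points where it touches `X`, until it touches `X` in a further point. -/
theorem exists_supporting_card_lt {X : Finset (Ambient d)}
    (hXS : (X : Set (Ambient d)) ⊆ UnitSphere d) (hXgen : IsGeneric (X : Set (Ambient d)))
    (hcard : d + 2 ≤ X.card) {c : Ambient d} {h : ℝ} (hc : c ≠ 0)
    (hle : ∀ x ∈ X, inner ℝ c x ≤ h) (hne : (X.filter fun x => inner ℝ c x = h).Nonempty)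
    (hlt : (X.filter fun x => inner ℝ c x = h).card ≤ d) :
    ∃ c' : Ambient d, c' ≠ 0 ∧ ∃ h' : ℝ, (∀ x ∈ X, inner ℝ c' x ≤ h') ∧
      (X.filter fun x => inner ℝ c x = h) ⊂ X.filter fun x => inner ℝ c' x = h' := by
  obtain ⟨e, he, hec, k, hk⟩ := exists_hyperplane_orthogonal _ hne hlt c
  -- By genericity some point of X is off the hyperplane of e; changing the sign of e puts it on the
  -- positive side.
  obtain ⟨e, he, hec, k, hk, hpos⟩ : ∃ e : Ambient d, e ≠ 0 ∧ inner ℝ e c = 0 ∧ ∃ k : ℝ,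
      (∀ x ∈ X.filter fun x => inner ℝ c x = h, inner ℝ e x = k) ∧
      ∃ x ∈ X, k < inner ℝ e x := by
    have := hXgen.not_hyperplane hXS le_rfl hcard he k
    push Not at this
    obtain ⟨x, hx, hxk⟩ := this
    rcases lt_or_gt_of_ne hxk with hlt | hgt
    · refine ⟨-e, neg_ne_zero.2 he, by rw [inner_neg_left, hec, neg_zero], -k, fun y hy => ?_,
        x, hx, ?_⟩
      · rw [inner_neg_left, hk y hy]
      · rw [inner_neg_left]; linarith
    · exact ⟨e, he, hec, k, hk, x, hx, hgt⟩
  obtain ⟨x₁, hx₁, hx₁k⟩ := hpos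
  -- The quotient is the parameter t at which the hyperplane with normal c + t • e through the old
  -- contact points reaches x. The least one keeps X on one side and its minimizer y is the new
  -- contact point; points with ⟨e, x⟩ ≤ k are never crossed.
  obtain ⟨y, hy, hmin⟩ := (X.filter fun x => k < inner ℝ e x).exists_min_image
    (fun x => (h - inner ℝ c x) / (inner ℝ e x - k)) ⟨x₁, Finset.mem_filter.2 ⟨hx₁, hx₁k⟩⟩
  obtain ⟨hyX, hyk⟩ := Finset.mem_filter.1 hy
  set t := (h - inner ℝ c y) / (inner ℝ e y - k)
  have ht0 : 0 ≤ t := div_nonneg (by linarith [hle y hyX]) (by linarith)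
  have hin : ∀ x, inner ℝ (c + t • e) x = inner ℝ c x + t * inner ℝ e x := fun x => by
    rw [inner_add_left, real_inner_smul_left]
  have hyt : t * (inner ℝ e y - k) = h - inner ℝ c y := div_mul_cancel₀ _ (by linarith)
  -- As e is orthogonal to c, ⟨c + t • e, c⟩ = ⟨c, c⟩, so the tilted normal cannot vanish.
  refine ⟨c + t • e, fun h0 => hc ?_, h + t * k, fun x hx => ?_, ?_⟩
  · have := hin c
    rw [h0, inner_zero_left, hec, mul_zero, add_zero] at this
    exact inner_self_eq_zero.1 this.symm
  · rw [hin]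
    rcases le_or_gt (inner ℝ e x) k with hxk | hxk
    · nlinarith [hle x hx]
    · have := hmin x (Finset.mem_filter.2 ⟨hx, hxk⟩)
      rw [le_div_iff₀ (by linarith)] at this
      linarith
  · refine (Finset.ssubset_iff_of_subset fun x hx => ?_).2
      ⟨y, Finset.mem_filter.2 ⟨hyX, by rw [hin]; linarith⟩, fun hy' => ?_⟩
    · rw [Finset.mem_filter, hin, hk x hx, (Finset.mem_filter.1 hx).2]
      exact ⟨(Finset.mem_filter.1 hx).1, rfl⟩
    · exact hyk.ne' (hk y hy')

open Classical in
/-- The points where a supporting hyperplane touches `X` form a Delaunay simplex. -/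
theorem touching_mem_delaunay {X : Finset (Ambient d)}
    (hXS : (X : Set (Ambient d)) ⊆ UnitSphere d) (hXgen : IsGeneric (X : Set (Ambient d)))
    (hcard : d + 2 ≤ X.card) {c : Ambient d} {h : ℝ} (hc : c ≠ 0)
    (hle : ∀ x ∈ X, inner ℝ c x ≤ h) (hne : (X.filter fun x => inner ℝ c x = h).Nonempty) :
    (X.filter fun x => inner ℝ c x = h) ∈ (delaunay (X : Set (Ambient d))).faces := by
  -- Induction on the number of points not touched: tilting adds contact points until there are at
  -- least d + 1, and genericity forbids d + 2.
  induction hn : X.card - (X.filter fun x => inner ℝ c x = h).card using Nat.strong_induction_on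
    generalizing c h with
  | _ n ih =>
    rcases le_or_gt (X.filter fun x => inner ℝ c x = h).card d with hlt | hgt
    · obtain ⟨c', hc', h', hle', hss⟩ := exists_supporting_card_lt hXS hXgen hcard hc hle hne hlt
      have hlt' := Finset.card_lt_card hss
      have hX' := Finset.card_filter_le X fun x => inner ℝ c' x = h'
      have := ih _ (by omega) hc' hle' (hne.mono hss.subset) rfl
      exact ((delaunay (X : Set (Ambient d))).isRelLowerSet_faces this).2 hss.subset hne
    · refine (mem_delaunay_iff hXS).2 ⟨hne, _, Finset.coe_subset.2 (Finset.filter_subset _ X), ?_,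
        Finset.Subset.refl _, c, hc, h, fun x hx => (Finset.mem_filter.1 hx).2, hle⟩
      by_contra hcon
      exact hXgen.not_hyperplane hXS (Finset.coe_subset.2 (Finset.filter_subset _ X))
        (by omega) hc h fun x hx => (Finset.mem_filter.1 hx).2

/-- If `v` lies beyond a supporting hyperplane of `X \ {v}`, then every point of `X \ {v}` on that
hyperplane is joined to `v` by an edge of the Delaunay complex of `X`. -/
theorem mem_closedStar_of_visible {X : Set (Ambient d)} (hXfin : X.Finite)
    (hXS : X ⊆ UnitSphere d) (hXgen : IsGeneric X) (hcard : d + 2 ≤ X.ncard) (h2 : 2 < X.ncard)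
    {v w c : Ambient d} {h : ℝ} (hv : v ∈ X) (hw : w ∈ X \ {v})
    (hle : ∀ x ∈ X \ {v}, inner ℝ c x ≤ h) (hwc : inner ℝ c w = h) (hvc : h < inner ℝ c v) :
    w ∈ vertexSet (closedStar (delaunay X) v) := by
  classical
  lift X to Finset (Ambient d) using hXfin
  rw [Set.ncard_coe_finset] at hcard h2
  have hnorm : ∀ x ∈ X, ‖x‖ = 1 := fun x hx => by simpa using hXS hx
  have hlt : ∀ x ∈ X, x ≠ w → inner ℝ w x < 1 := fun x hx hxw =>
    (inner_lt_one_iff_real_of_norm_eq_one (hnorm w hw.1) (hnorm x hx)).2 hxw.symm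
  have hww : inner ℝ w w = (1 : ℝ) := by
    rw [real_inner_self_eq_norm_sq, hnorm w hw.1, one_pow]
  have hvw : inner ℝ w v < 1 := hlt v hv fun h => hw.2 h.symm
  -- This s makes the functional c + s • w take the same value h + s at v and at w.
  set s := (inner ℝ c v - h) / (1 - inner ℝ w v)
  have hs0 : 0 < s := div_pos (by linarith) (by linarith)
  have hsv : s * (1 - inner ℝ w v) = inner ℝ c v - h := div_mul_cancel₀ _ (by linarith)
  have hin : ∀ x, inner ℝ (c + s • w) x = inner ℝ c x + s * inner ℝ w x := fun x => by
    rw [inner_add_left, real_inner_smul_left]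
  have hinw : inner ℝ (c + s • w) w = h + s := by rw [hin, hww, hwc, mul_one]
  have hinv : inner ℝ (c + s • w) v = h + s := by rw [hin]; linarith
  have hstrict : ∀ x ∈ X, x ≠ v → x ≠ w → inner ℝ (c + s • w) x < h + s := by
    intro x hx hxv hxw
    rw [hin]
    nlinarith [hle x ⟨hx, hxv⟩, hlt x hx hxw]
  have hc : c + s • w ≠ 0 := by
    intro h0
    -- A zero normal would give height 0 = h + s everywhere, but a third point u is strictly below h
    -- + s.
    obtain ⟨u, hu⟩ : ∃ u, u ∈ X \ {v, w} := by
      refine Finset.card_pos.1 ?_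
      have := Finset.le_card_sdiff {v, w} X
      have := Finset.card_le_two (a := v) (b := w)
      omega
    simp only [Finset.mem_sdiff, Finset.mem_insert, Finset.mem_singleton, not_or] at hu
    have h3 := hstrict u hu.1 hu.2.1 hu.2.2
    rw [h0, inner_zero_left] at h3 hinw
    linarith
  have hmemw : w ∈ X.filter fun x => inner ℝ (c + s • w) x = h + s :=
    Finset.mem_filter.2 ⟨hw.1, hinw⟩
  have hmemv : v ∈ X.filter fun x => inner ℝ (c + s • w) x = h + s :=
    Finset.mem_filter.2 ⟨hv, hinv⟩
  have hface := touching_mem_delaunay hXS hXgen hcard hc (h := h + s) (fun x hx => ?_) ⟨w, hmemw⟩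
  · exact ⟨Finset.singleton_nonempty w, _, ⟨hface, hmemv⟩, Finset.singleton_subset_iff.2 hmemw⟩
  · by_cases hxv : x = v
    · rw [hxv, hinv]
    by_cases hxw : x = w
    · rw [hxw, hinw]
    exact (hstrict x hx hxv hxw).le

end SupportingHyperplanes

/-! ### Radial projection from the sphere to the Delaunay complex -/

section RadialProjection

variable {d : ℕ}

/-- The convex combinations of points of `X`, as weight functions. -/
def weightsOn (X : Set (Ambient d)) : Set (Ambient d → ℝ) :=
  {a | (∀ x, 0 ≤ a x) ∧ Function.support a ⊆ X ∧ ∑ᶠ x, a x = 1}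

theorem realization_delaunay_subset (X : Set (Ambient d)) :
    realization (delaunay X) ⊆ weightsOn X := by
  rintro a ⟨h0, ⟨σ, ⟨-, τ, hτX, -, -, hστ⟩, hs⟩, h1⟩
  exact ⟨h0, hs ▸ fun x hx => hτX (hστ hx), h1⟩

theorem weightedPoint_eq_sum {a : Ambient d → ℝ} {X : Finset (Ambient d)}
    (ha : Function.support a ⊆ X) : weightedPoint a = ∑ x ∈ X, a x • x :=
  finsum_eq_sum_of_support_subset _ fun x hx => ha fun h0 => hx (by simp [h0])

theorem weightsOn_sum {X : Finset (Ambient d)} {a : Ambient d → ℝ}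
    (ha : a ∈ weightsOn (X : Set (Ambient d))) : ∑ x ∈ X, a x = 1 := by
  rw [← finsum_eq_sum_of_support_subset _ ha.2.1, ha.2.2]

/-- Since the weights sum to one, slack averages. For a supporting hyperplane all slacks are
nonnegative, so zero total slack forces the weights onto the contact points. -/
theorem sub_inner_weightedPoint {X : Finset (Ambient d)} {a : Ambient d → ℝ}
    (ha : a ∈ weightsOn (X : Set (Ambient d))) (c : Ambient d) (h : ℝ) :
    h - inner ℝ c (weightedPoint a) = ∑ x ∈ X, a x * (h - inner ℝ c x) := by
  simp_rw [mul_sub, Finset.sum_sub_distrib, ← Finset.sum_mul, weightsOn_sum ha, one_mul,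
    weightedPoint_eq_sum ha.2.1, inner_sum, real_inner_smul_right]

theorem inner_weightedPoint_le {X : Finset (Ambient d)} {a : Ambient d → ℝ}
    (ha : a ∈ weightsOn (X : Set (Ambient d))) {c : Ambient d} {h : ℝ}
    (hle : ∀ x ∈ X, inner ℝ c x ≤ h) : inner ℝ c (weightedPoint a) ≤ h := by
  rw [← sub_nonneg, sub_inner_weightedPoint ha]
  exact Finset.sum_nonneg fun x hx => mul_nonneg (ha.1 x) (sub_nonneg.2 (hle x hx))

theorem inner_weightedPoint_eq_iff {X : Finset (Ambient d)} {a : Ambient d → ℝ}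
    (ha : a ∈ weightsOn (X : Set (Ambient d))) {c : Ambient d} {h : ℝ}
    (hle : ∀ x ∈ X, inner ℝ c x ≤ h) :
    inner ℝ c (weightedPoint a) = h ↔ ∀ x ∈ Function.support a, inner ℝ c x = h := by
  rw [eq_comm, ← sub_eq_zero, sub_inner_weightedPoint ha, Finset.sum_eq_zero_iff_of_nonneg
    fun x hx => mul_nonneg (ha.1 x) (sub_nonneg.2 (hle x hx))]
  constructor
  · intro h1 x hx
    have := (mul_eq_zero.1 (h1 x (ha.2.1 hx))).resolve_left hx
    linarith
  · intro h1 x _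
    by_cases hx : a x = 0
    · rw [hx, zero_mul]
    · rw [h1 x hx, sub_self, mul_zero]

theorem exists_weightsOn_of_mem_convexHull {X : Finset (Ambient d)} {p : Ambient d}
    (hp : p ∈ convexHull ℝ (X : Set (Ambient d))) :
    ∃ a ∈ weightsOn (X : Set (Ambient d)), weightedPoint a = p := by
  classical
  obtain ⟨w, h0, h1, hwp⟩ := Finset.mem_convexHull'.1 hp
  have hs : Function.support (fun x => if x ∈ X then w x else 0) ⊆ (X : Set (Ambient d)) := by
    intro x hx
    by_contra hxX
    exact hx (if_neg hxX)
  refine ⟨fun x => if x ∈ X then w x else 0, ⟨fun x => ?_, hs, ?_⟩, ?_⟩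
  · dsimp only
    split_ifs with hx
    exacts [h0 x hx, le_rfl]
  · rw [finsum_eq_sum_of_support_subset _ hs, ← h1]
    exact Finset.sum_congr rfl fun x hx => if_pos hx
  · rw [weightedPoint_eq_sum hs, ← hwp]
    exact Finset.sum_congr rfl fun x hx => by rw [if_pos hx]

/-- A small positive multiple of c still lies in the hull, and ⟨c, ·⟩ is positive there. -/
theorem pos_of_zero_mem_interior_convexHull {X : Set (Ambient d)}
    (h0 : (0 : Ambient d) ∈ interior (convexHull ℝ X)) {c : Ambient d} (hc : c ≠ 0) {h : ℝ}
    (hle : ∀ x ∈ X, inner ℝ c x ≤ h) : 0 < h := by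
  have hcont : Filter.Tendsto (fun t : ℝ => t • c) (nhdsWithin 0 (Ioi 0)) (nhds 0) := by
    have : Continuous fun t : ℝ => t • c := by fun_prop
    simpa using (this.tendsto 0).mono_left nhdsWithin_le_nhds
  obtain ⟨t, htc, ht⟩ := ((hcont.eventually (mem_interior_iff_mem_nhds.1 h0)).and
    self_mem_nhdsWithin).exists
  have hsub : convexHull ℝ X ⊆ {y | inner ℝ c y ≤ h} :=
    convexHull_min hle (convex_halfSpace_le (innerₛₗ ℝ c).isLinear h)
  have h1 : inner ℝ c (t • c) ≤ h := hsub htc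
  rw [real_inner_smul_right] at h1
  exact lt_of_lt_of_le (mul_pos ht (real_inner_self_pos.2 hc)) h1

/-- Fewer points would lie on a hyperplane, which supports them from both sides, making both h and
-h positive. -/
theorem card_of_zero_mem_interior_convexHull {X : Finset (Ambient d)}
    (h0 : (0 : Ambient d) ∈ interior (convexHull ℝ (X : Set (Ambient d)))) : d + 2 ≤ X.card := by
  by_contra hcon
  obtain ⟨c, hc, h, hX⟩ := exists_hyperplane X (by omega)
  have h1 := pos_of_zero_mem_interior_convexHull h0 hc fun x hx => (hX x hx).le
  have h2 := pos_of_zero_mem_interior_convexHull h0 (neg_ne_zero.2 hc) (h := -h)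
    fun x hx => by rw [inner_neg_left, hX x hx]
  linarith

/-- Every ray from an interior point leaves the convex hull through a supporting hyperplane. -/
theorem exists_supporting_on_ray {X : Finset (Ambient d)}
    (h0 : (0 : Ambient d) ∈ interior (convexHull ℝ (X : Set (Ambient d))))
    {z : Ambient d} (hz : z ≠ 0) :
    ∃ t : ℝ, 0 < t ∧ t • z ∈ convexHull ℝ (X : Set (Ambient d)) ∧ ∃ c : Ambient d, c ≠ 0 ∧
      ∀ x ∈ X, inner ℝ c x ≤ inner ℝ c (t • z) := by
  set C := convexHull ℝ (X : Set (Ambient d))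
  have hCcomp : IsCompact C := X.finite_toSet.isCompact_convexHull (𝕜 := ℝ)
  have hlarger : ∀ t : ℝ, t • z ∈ interior C → ∃ s, t < s ∧ s • z ∈ C := by
    intro t ht
    have hcont : Filter.Tendsto (fun s : ℝ => s • z) (nhdsWithin t (Ioi t)) (nhds (t • z)) := by
      have : Continuous fun s : ℝ => s • z := by fun_prop
      exact (this.tendsto t).mono_left nhdsWithin_le_nhds
    obtain ⟨s, hs, hts⟩ := ((hcont.eventually (mem_interior_iff_mem_nhds.1 ht)).and
      self_mem_nhdsWithin).exists
    exact ⟨s, hts, hs⟩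
  -- The greatest parameter t with t • z in the hull gives the exit point, which cannot be interior.
  have hT : IsCompact ((fun t : ℝ => t • z) ⁻¹' C) :=
    (isClosedEmbedding_smul_left (𝕜 := ℝ) hz).isCompact_preimage hCcomp
  obtain ⟨t, htC, htmax⟩ := hT.exists_isGreatest
    ⟨0, by simpa using interior_subset h0⟩
  have htpos : 0 < t := by
    obtain ⟨s, hs, hsC⟩ := hlarger 0 (by simpa using h0)
    exact lt_of_lt_of_le hs (htmax hsC)
  have hnot : t • z ∉ interior C := fun hmem => by
    obtain ⟨s, hs, hsC⟩ := hlarger t hmem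
    exact absurd (htmax hsC) (not_le.2 hs)
  obtain ⟨f, hf⟩ := geometric_hahn_banach_open_point (convex_convexHull ℝ _).interior
    isOpen_interior hnot
  have hfc : ∀ x, inner ℝ ((InnerProductSpace.toDual ℝ (Ambient d)).symm f) x = f x :=
    fun x => InnerProductSpace.toDual_symm_apply
  refine ⟨t, htpos, htC, (InnerProductSpace.toDual ℝ (Ambient d)).symm f, fun hc => ?_,
    fun x hx => ?_⟩
  · have h1 := hf 0 h0
    rw [← hfc, ← hfc, hc, inner_zero_left, inner_zero_left] at h1
    exact lt_irrefl _ h1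
  · rw [hfc, hfc]
    -- Separation bounds f only on the interior of the hull, but X lies in the closure of that
    -- interior.
    have hcl : closure (interior C) ⊆ {y | f y ≤ f (t • z)} :=
      closure_minimal (fun y hy => (hf y hy).le) (isClosed_le f.continuous continuous_const)
    refine hcl ?_
    rw [(convex_convexHull ℝ _).closure_interior_eq_closure_of_nonempty_interior ⟨0, h0⟩]
    exact subset_closure (subset_convexHull ℝ _ hx)

/-- In a generic set of at least `d + 2` points, any `d + 1` points are affinely independent. -/
theorem IsGeneric.weights_eq {X τ : Finset (Ambient d)}
    (hXS : (X : Set (Ambient d)) ⊆ UnitSphere d) (hXgen : IsGeneric (X : Set (Ambient d)))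
    (hcard : d + 2 ≤ X.card) (hτX : τ ⊆ X) (hτ : τ.card ≤ d + 1) {a b : Ambient d → ℝ}
    (ha : a ∈ weightsOn (τ : Set (Ambient d))) (hb : b ∈ weightsOn (τ : Set (Ambient d)))
    (hab : weightedPoint a = weightedPoint b) : a = b := by
  classical
  obtain ⟨S, hτS, hSX, hS⟩ := Finset.exists_subsuperset_card_eq hτX (by omega : _ ≤ d + 2) hcard
  have hcoe : (τ : Set (Ambient d)) ⊆ S := Finset.coe_subset.2 hτS
  have haS : a ∈ weightsOn (S : Set (Ambient d)) := ⟨ha.1, ha.2.1.trans hcoe, ha.2.2⟩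
  have hbS : b ∈ weightsOn (S : Set (Ambient d)) := ⟨hb.1, hb.2.1.trans hcoe, hb.2.2⟩
  funext y
  by_cases hy : y ∈ S
  -- The hyperplane through the other d + 1 points of S isolates the weight of y, up to the factor h
  -- - ⟨c, y⟩, which is nonzero by genericity.
  · obtain ⟨c, hc, h, hSc⟩ := exists_hyperplane (S.erase y)
      (by rw [Finset.card_erase_of_mem hy]; omega)
    have hsingle : ∀ e ∈ weightsOn (S : Set (Ambient d)),
        h - inner ℝ c (weightedPoint e) = e y * (h - inner ℝ c y) := fun e he => by
      rw [sub_inner_weightedPoint he]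
      refine Finset.sum_eq_single_of_mem y hy fun x hx hxy => ?_
      rw [hSc x (Finset.mem_erase.2 ⟨hxy, hx⟩), sub_self, mul_zero]
    have heq := (hsingle a haS).symm.trans ((by rw [hab]) : _ = _) |>.trans (hsingle b hbS)
    refine mul_right_cancel₀ (fun hzero => ?_) heq
    refine hXgen.not_hyperplane hXS (Finset.coe_subset.2 hSX) hS.ge hc h fun x hx => ?_
    by_cases hxy : x = y
    · rw [hxy]; linarith
    · exact hSc x (Finset.mem_erase.2 ⟨hxy, hx⟩)
  · rw [Function.notMem_support.1 fun hh => hy (haS.2.1 hh),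
      Function.notMem_support.1 fun hh => hy (hbS.2.1 hh)]

/-- A point of the realization has weights carried by a supporting hyperplane. -/
theorem exists_supporting_of_mem_realization {X : Set (Ambient d)} (hXS : X ⊆ UnitSphere d)
    {a : Ambient d → ℝ} (ha : a ∈ realization (delaunay X)) :
    ∃ c : Ambient d, c ≠ 0 ∧ ∃ h : ℝ, (∀ x ∈ X, inner ℝ c x ≤ h) ∧
      ∀ x ∈ Function.support a, inner ℝ c x = h := by
  obtain ⟨-, ⟨σ, hσ, hs⟩, -⟩ := ha
  obtain ⟨-, τ, -, -, hστ, c, hc, h, hτ, hX⟩ := (mem_delaunay_iff hXS).1 hσ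
  exact ⟨c, hc, h, hX, hs ▸ fun x hx => hτ x (hστ hx)⟩

/-- Along a ray, the point of the realization is the farthest point of the convex hull. -/
theorem le_of_mem_realization_of_ray {X : Finset (Ambient d)}
    (hXS : (X : Set (Ambient d)) ⊆ UnitSphere d)
    (h0 : (0 : Ambient d) ∈ interior (convexHull ℝ (X : Set (Ambient d))))
    {a b : Ambient d → ℝ} (ha : a ∈ realization (delaunay (X : Set (Ambient d))))
    (hb : b ∈ weightsOn (X : Set (Ambient d))) {z : Ambient d} {s t : ℝ} (hs : 0 < s)
    (hsa : weightedPoint a = s • z) (htb : weightedPoint b = t • z) : t ≤ s := by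
  obtain ⟨c, hc, h, hX, hsupp⟩ := exists_supporting_of_mem_realization hXS ha
  -- The functional equals h > 0 at s • z and is at most h at t • z; it is therefore positive at z,
  -- which compares t with s.
  have hpos := pos_of_zero_mem_interior_convexHull h0 hc hX
  have h1 := (inner_weightedPoint_eq_iff (realization_delaunay_subset _ ha) hX).2 hsupp
  have h2 := inner_weightedPoint_le hb hX
  rw [hsa, real_inner_smul_right] at h1
  rw [htb, real_inner_smul_right, ← h1] at h2
  exact le_of_mul_le_mul_right h2 (pos_of_mul_pos_right (h1 ▸ hpos) hs.le)

/-- A point of the realization is determined by its position in space, even among all convex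
combinations of points of `X`. -/
theorem eq_of_weightedPoint_eq {X : Finset (Ambient d)}
    (hXS : (X : Set (Ambient d)) ⊆ UnitSphere d) (hXgen : IsGeneric (X : Set (Ambient d)))
    (hcard : d + 2 ≤ X.card)
    {a b : Ambient d → ℝ} (ha : a ∈ realization (delaunay (X : Set (Ambient d))))
    (hb : b ∈ weightsOn (X : Set (Ambient d))) (hab : weightedPoint a = weightedPoint b) :
    a = b := by
  classical
  obtain ⟨c, hc, h, hX, hsupp⟩ := exists_supporting_of_mem_realization hXS ha
  have haX := realization_delaunay_subset _ ha
  have h1 := (inner_weightedPoint_eq_iff haX hX).2 hsupp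
  have hsuppb := (inner_weightedPoint_eq_iff hb hX).1 (hab ▸ h1)
  have hsub : ∀ e ∈ weightsOn (X : Set (Ambient d)),
      (∀ x ∈ Function.support e, inner ℝ c x = h) →
      e ∈ weightsOn ((X.filter fun x => inner ℝ c x = h : Finset (Ambient d)) :
        Set (Ambient d)) := fun e he hes =>
    ⟨he.1, fun x hx => Finset.mem_coe.2 (Finset.mem_filter.2 ⟨he.2.1 hx, hes x hx⟩), he.2.2⟩
  refine hXgen.weights_eq hXS hcard (Finset.filter_subset _ X) ?_ (hsub a haX hsupp)
    (hsub b hb hsuppb) hab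
  by_contra hcon
  exact hXgen.not_hyperplane hXS (Finset.coe_subset.2 (Finset.filter_subset _ X))
    (by omega) hc h fun x hx => (Finset.mem_filter.1 hx).2

/-- Any convex combination representing the exit point of the ray is carried by the contact points
of a supporting hyperplane there, and these form a Delaunay simplex. -/
theorem exists_mem_realization_of_ray {X : Finset (Ambient d)}
    (hXS : (X : Set (Ambient d)) ⊆ UnitSphere d) (hXgen : IsGeneric (X : Set (Ambient d)))
    (h0 : (0 : Ambient d) ∈ interior (convexHull ℝ (X : Set (Ambient d))))
    {z : Ambient d} (hz : z ≠ 0) :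
    ∃ a ∈ realization (delaunay (X : Set (Ambient d))), ∃ t : ℝ, 0 < t ∧
      weightedPoint a = t • z := by
  classical
  obtain ⟨t, ht, htC, c, hc, hle⟩ := exists_supporting_on_ray h0 hz
  obtain ⟨a, ha, hap⟩ := exists_weightsOn_of_mem_convexHull htC
  have hsupp := (inner_weightedPoint_eq_iff ha hle).1 (by rw [hap])
  have hsub : Function.support a ⊆
      ((X.filter fun x => inner ℝ c x = inner ℝ c (t • z) : Finset (Ambient d)) :
        Set (Ambient d)) :=
    fun x hx => Finset.mem_coe.2 (Finset.mem_filter.2 ⟨ha.2.1 hx, hsupp x hx⟩)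
  have hfin : (Function.support a).Finite := (Finset.finite_toSet _).subset hsub
  have hne : hfin.toFinset.Nonempty := by
    rw [Set.Finite.toFinset_nonempty, Function.support_nonempty_iff]
    rintro rfl
    simpa using ha.2.2
  have hsub' : hfin.toFinset ⊆ X.filter fun x => inner ℝ c x = inner ℝ c (t • z) :=
    fun x hx => hsub (hfin.mem_toFinset.1 hx)
  have hface := touching_mem_delaunay hXS hXgen (card_of_zero_mem_interior_convexHull h0) hc hle
    (hne.mono hsub')
  exact ⟨a, ⟨ha.1, ⟨hfin.toFinset, ((delaunay _).isRelLowerSet_faces hface).2 hsub' hne,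
    hfin.coe_toFinset⟩, ha.2.2⟩, t, ht, hap⟩

theorem weightedPoint_ne_zero {X : Finset (Ambient d)}
    (hXS : (X : Set (Ambient d)) ⊆ UnitSphere d)
    (h0 : (0 : Ambient d) ∈ interior (convexHull ℝ (X : Set (Ambient d))))
    {a : Ambient d → ℝ} (ha : a ∈ realization (delaunay (X : Set (Ambient d)))) :
    weightedPoint a ≠ 0 := by
  obtain ⟨c, hc, h, hX, hsupp⟩ := exists_supporting_of_mem_realization hXS ha
  have hpos := pos_of_zero_mem_interior_convexHull h0 hc hX
  have h1 := (inner_weightedPoint_eq_iff (realization_delaunay_subset _ ha) hX).2 hsupp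
  intro hzero
  rw [hzero, inner_zero_right] at h1
  exact hpos.ne h1

/-- The realization of a finite complex is compact. -/
theorem isCompact_realization {V : Type*} {K : PreAbstractSimplicialComplex V}
    (hK : K.faces.Finite) : IsCompact (realization K) := by
  classical
  have heq : realization K = ⋃ σ ∈ K.faces,
      {a : V → ℝ | (∀ v, 0 ≤ a v) ∧ (∀ v, v ∉ σ → a v = 0) ∧ ∑ v ∈ σ, a v = 1} := by
    ext a
    simp only [mem_iUnion, exists_prop]
    constructor
    · rintro ⟨h0, ⟨σ, hσ, hs⟩, h1⟩
      refine ⟨σ, hσ, h0, fun v hv => ?_, ?_⟩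
      · exact Function.notMem_support.1 fun hh => hv (hs.ge hh)
      · rw [← h1, finsum_eq_sum_of_support_subset _ hs.ge]
    · rintro ⟨σ, hσ, h0, hv, h1⟩
      have hsub : Function.support a ⊆ σ := fun v hva => by
        by_contra hvs
        exact hva (hv v hvs)
      have hfin := σ.finite_toSet.subset hsub
      refine ⟨h0, ⟨hfin.toFinset, (K.isRelLowerSet_faces hσ).2 (by simpa using hsub) ?_,
        hfin.coe_toFinset⟩, by rw [finsum_eq_sum_of_support_subset _ hsub, h1]⟩
      rw [Set.Finite.toFinset_nonempty, Function.support_nonempty_iff]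
      rintro rfl
      simp at h1
  rw [heq]
  refine hK.isCompact_biUnion fun σ _ => ?_
  -- V may be infinite, so each simplex is treated as a closed subset of the cube [0, 1]^V, compact
  -- by Tychonoff.
  refine (isCompact_univ_pi fun _ : V => isCompact_Icc (a := (0 : ℝ)) (b := 1)).of_isClosed_subset
    ?_ ?_
  · have hinter : {a : V → ℝ | (∀ v, 0 ≤ a v) ∧ (∀ v, v ∉ σ → a v = 0) ∧ ∑ v ∈ σ, a v = 1} =
        (⋂ v, {a | 0 ≤ a v}) ∩ ((⋂ v, ⋂ (_ : v ∉ σ), {a | a v = 0}) ∩ {a | ∑ v ∈ σ, a v = 1}) := by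
      ext a
      simp
    rw [hinter]
    refine IsClosed.inter ?_ (IsClosed.inter ?_ ?_)
    · exact isClosed_iInter fun v => isClosed_le continuous_const (continuous_apply v)
    · exact isClosed_iInter fun v => isClosed_iInter fun _ =>
        isClosed_eq (continuous_apply v) continuous_const
    · exact isClosed_eq (continuous_finsetSum _ fun v _ => continuous_apply v) continuous_const
  · rintro a ⟨h0, hv, h1⟩ v -
    refine ⟨h0 v, ?_⟩
    by_cases hvs : v ∈ σ
    · rw [← h1]
      exact Finset.single_le_sum (fun w _ => h0 w) hvs
    · rw [hv v hvs]
      exact zero_le_one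

theorem continuous_weightedPoint (X : Finset (Ambient d)) :
    Continuous fun a : realization (delaunay (X : Set (Ambient d))) => weightedPoint a.1 := by
  have heq : (fun a : realization (delaunay (X : Set (Ambient d))) => weightedPoint a.1)
      = fun a => ∑ x ∈ X, a.1 x • x :=
    funext fun a => weightedPoint_eq_sum (realization_delaunay_subset _ a.2).2.1
  rw [heq]
  exact continuous_finsetSum _ fun x _ =>
    ((continuous_apply x).comp continuous_subtype_val).smul continuous_const

/-- If the origin is interior to the convex hull of `X`, then radial projection is a homeomorphism
from the sphere to the Delaunay complex. -/
theorem exists_isRadialProjection {X : Set (Ambient d)} (hXfin : X.Finite)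
    (hXS : X ⊆ UnitSphere d) (hXgen : IsGeneric X)
    (h0 : (0 : Ambient d) ∈ interior (convexHull ℝ X)) :
    ∃ r : UnitSphere d ≃ₜ realization (delaunay X), IsRadialProjection (delaunay X) r := by
  lift X to Finset (Ambient d) using hXfin
  have hne : ∀ a : realization (delaunay (X : Set (Ambient d))), weightedPoint a.1 ≠ 0 :=
    fun a => weightedPoint_ne_zero hXS h0 a.2
  -- The explicit map goes from the complex to the sphere; as a continuous bijection from a compact
  -- space to a Hausdorff space it has a continuous inverse, the radial projection.
  let f : realization (delaunay (X : Set (Ambient d))) → UnitSphere d := fun a =>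
    ⟨‖weightedPoint a.1‖⁻¹ • weightedPoint a.1, inv_norm_smul_mem_unitSphere (hne a)⟩
  have hf : ∀ a, weightedPoint a.1 = ‖weightedPoint a.1‖ • (f a : Ambient d) := fun a =>
    (smul_inv_smul₀ (norm_ne_zero_iff.2 (hne a)) _).symm
  have hfc : Continuous f := by
    have hc := continuous_weightedPoint X
    exact ((hc.norm.inv₀ fun a => norm_ne_zero_iff.2 (hne a)).smul hc).subtype_mk _
  have hinj : Function.Injective f := by
    intro a b hab
    have hpa : 0 < ‖weightedPoint a.1‖ := norm_pos_iff.2 (hne a)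
    have hpb : 0 < ‖weightedPoint b.1‖ := norm_pos_iff.2 (hne b)
    have h1 := hf a
    have h2 := hf b
    rw [← hab] at h2
    have hnorm : ‖weightedPoint a.1‖ = ‖weightedPoint b.1‖ := le_antisymm
      (le_of_mem_realization_of_ray hXS h0 b.2 (realization_delaunay_subset _ a.2) hpb h2 h1)
      (le_of_mem_realization_of_ray hXS h0 a.2 (realization_delaunay_subset _ b.2) hpa h1 h2)
    refine Subtype.ext (eq_of_weightedPoint_eq hXS hXgen
      (card_of_zero_mem_interior_convexHull h0) a.2 (realization_delaunay_subset _ b.2) ?_)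
    rw [h1, h2, hnorm]
  have hsurj : Function.Surjective f := by
    intro z
    have hz : ‖(z : Ambient d)‖ = 1 := by simp
    obtain ⟨a, ha, t, ht, hat⟩ := exists_mem_realization_of_ray hXS hXgen h0
      (z := z) (norm_ne_zero_iff.1 (by rw [hz]; exact one_ne_zero))
    refine ⟨⟨a, ha⟩, Subtype.ext ?_⟩
    change ‖weightedPoint a‖⁻¹ • weightedPoint a = z
    rw [hat, norm_smul, hz, mul_one, Real.norm_of_nonneg ht.le, inv_smul_smul₀ ht.ne']
  have : CompactSpace (realization (delaunay (X : Set (Ambient d)))) :=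
    isCompact_iff_compactSpace.1 (isCompact_realization (delaunay_finite X.finite_toSet))
  let e : realization (delaunay (X : Set (Ambient d))) ≃ₜ UnitSphere d :=
    Continuous.homeoOfEquivCompactToT2 (f := Equiv.ofBijective f ⟨hinj, hsurj⟩) hfc
  refine ⟨e.symm, fun z => ⟨‖weightedPoint (e.symm z).1‖, norm_pos_iff.2 (hne _), ?_⟩⟩
  have h1 := hf (e.symm z)
  rwa [show f (e.symm z) = z from e.apply_symm_apply z] at h1

end RadialProjection

/-! ### Removing a vertex: simpliciality, contiguity and homotopy -/

section Removal

variable {W : Type*}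

theorem IsSimplexOf.mono {V : Type*} {K : PreAbstractSimplicialComplex V} {S T : Set V}
    (hS : IsSimplexOf K S) (hTS : T ⊆ S) (hT : T.Nonempty) : IsSimplexOf K T := by
  obtain ⟨σ, hσ, rfl⟩ := hS
  have hfin := σ.finite_toSet.subset hTS
  exact ⟨hfin.toFinset, (K.isRelLowerSet_faces hσ).2 (by simpa using hTS) (by simpa using hT),
    hfin.coe_toFinset⟩

/-- Two maps into a realization are homotopic if their values always lie in a common simplex. -/
theorem homotopic_of_common_simplex {Z V : Type*} [TopologicalSpace Z]
    {K : PreAbstractSimplicialComplex V} (f₀ f₁ : C(Z, realization K))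
    (h : ∀ z, IsSimplexOf K (Function.support (f₀ z).1 ∪ Function.support (f₁ z).1)) :
    ContinuousMap.Homotopic f₀ f₁ := by
  have hmem : ∀ p : unitInterval × Z,
      (1 - (p.1 : ℝ)) • (f₀ p.2).1 + (p.1 : ℝ) • (f₁ p.2).1 ∈ realization K := by
    rintro ⟨t, z⟩
    obtain ⟨σ, hσ, hs⟩ := h z
    have h0 : Function.support (f₀ z).1 ⊆ σ := hs ▸ subset_union_left
    have h1 : Function.support (f₁ z).1 ⊆ σ := hs ▸ subset_union_right
    have hsub : Function.support ((1 - (t : ℝ)) • (f₀ z).1 + (t : ℝ) • (f₁ z).1) ⊆ σ := by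
      intro v hv
      by_contra hvs
      refine hv ?_
      have e0 : (f₀ z).1 v = 0 := Function.notMem_support.1 fun hh => hvs (h0 hh)
      have e1 : (f₁ z).1 v = 0 := Function.notMem_support.1 fun hh => hvs (h1 hh)
      simp [e0, e1]
    have hsum : ∑ᶠ v, ((1 - (t : ℝ)) • (f₀ z).1 + (t : ℝ) • (f₁ z).1) v = 1 := by
      rw [finsum_eq_sum_of_support_subset _ hsub]
      have s0 := (f₀ z).2.2.2
      have s1 := (f₁ z).2.2.2
      rw [finsum_eq_sum_of_support_subset _ h0] at s0
      rw [finsum_eq_sum_of_support_subset _ h1] at s1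
      simp only [Pi.add_apply, Pi.smul_apply, smul_eq_mul, Finset.sum_add_distrib,
        ← Finset.mul_sum, s0, s1]
      ring
    refine ⟨fun v => ?_, IsSimplexOf.mono ⟨σ, hσ, rfl⟩ hsub ?_, hsum⟩
    · have := mul_nonneg (sub_nonneg.2 t.2.2) ((f₀ z).2.1 v)
      have := mul_nonneg t.2.1 ((f₁ z).2.1 v)
      simp only [Pi.add_apply, Pi.smul_apply, smul_eq_mul]
      linarith
    · rw [Function.support_nonempty_iff]
      intro hzero
      rw [hzero] at hsum
      simp at hsum
  refine ⟨⟨⟨fun p => ⟨_, hmem p⟩, ?_⟩, fun z => ?_, fun z => ?_⟩⟩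
  · exact Continuous.subtype_mk (by fun_prop) _
  · exact Subtype.ext (by simp)
  · exact Subtype.ext (by simp)

/-- Removing a vertex that satisfies the simplex condition keeps the map simplicial. -/
theorem isSimplicialMap_delaunay_diff_singleton {d : ℕ} {L : PreAbstractSimplicialComplex W}
    {X : Set (Ambient d)} (hXfin : X.Finite) (hXS : X ⊆ UnitSphere d) (hXgen : IsGeneric X)
    {g : Ambient d → W} (hg : IsSimplicialMap (delaunay X) L g)
    {v : Ambient d} (hv : v ∈ X) (hsc : SimplexCondition (delaunay X) L g v) :
    IsSimplicialMap (delaunay (X \ {v})) L g := by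
  intro σ hσ
  obtain ⟨hne, τ, hτX, hτ, hστ, c, hc, h, hτh, hle⟩ :=
    (mem_delaunay_iff (sdiff_subset.trans hXS)).1 hσ
  rcases le_or_gt (inner ℝ c v) h with hvh | hvh
  · refine hg σ ((mem_delaunay_iff hXS).2
      ⟨hne, τ, hτX.trans sdiff_subset, hτ, hστ, c, hc, h, hτh, fun x hx => ?_⟩)
    by_cases hxv : x = v
    · rwa [hxv]
    · exact hle x ⟨hx, hxv⟩
  rcases Nat.eq_zero_or_pos d with rfl | hd
  -- For d = 0 the set X may have only two points, too few for the visibility lemma. Simplices are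
  -- then single points, and each x in X is a simplex of Del(X) because it maximizes ⟨x, ·⟩ on the
  -- sphere.
  · obtain ⟨x, rfl⟩ := Finset.card_eq_one.1 hτ
    have hx : x ∈ X := (hτX (Finset.mem_singleton_self x)).1
    have hx1 : ‖x‖ = 1 := by simpa using hXS hx
    refine hg σ ((mem_delaunay_iff hXS).2 ⟨hne, {x}, by simpa using hx, hτ, hστ, x, ?_, 1, ?_, ?_⟩)
    · exact norm_ne_zero_iff.1 (by rw [hx1]; exact one_ne_zero)
    · intro y hy
      rw [Finset.mem_singleton.1 hy, real_inner_self_eq_norm_sq, hx1, one_pow]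
    · intro y hy
      have hy1 : ‖y‖ = 1 := by simpa using hXS hy
      simpa [hx1, hy1] using real_inner_le_norm x y
  · have hcard : d + 2 ≤ X.ncard := by
      have h1 : (τ : Set (Ambient d)).ncard ≤ (X \ {v}).ncard :=
        Set.ncard_le_ncard hτX (hXfin.subset sdiff_subset)
      rw [Set.ncard_coe_finset, hτ, Set.ncard_sdiff_singleton_of_mem hv] at h1
      omega
    refine IsSimplexOf.mono hsc (image_mono fun w hw => ?_) (hne.to_set.image g)
    exact mem_closedStar_of_visible hXfin hXS hXgen hcard (by omega) hv (hτX (hστ hw)) hle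
      (hτh w (hστ hw)) hvh

/-- Removing a vertex that satisfies the simplex condition yields a contiguous map. -/
theorem areContiguous_delaunay_diff_singleton {d : ℕ} {L : PreAbstractSimplicialComplex W}
    {X : Set (Ambient d)} (hXfin : X.Finite) (hXS : X ⊆ UnitSphere d) (hXgen : IsGeneric X)
    {g : Ambient d → W} (hg : IsSimplicialMap (delaunay X) L g)
    {v : Ambient d} (hv : v ∈ X) (hsc : SimplexCondition (delaunay X) L g v)
    (h0 : (0 : Ambient d) ∈ interior (convexHull ℝ (X \ {v})))
    {r : UnitSphere d → realization (delaunay X)}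
    {r' : UnitSphere d → realization (delaunay (X \ {v}))}
    (hr : IsRadialProjection (delaunay X) r) (hr' : IsRadialProjection (delaunay (X \ {v})) r') :
    AreContiguous L r r' g g := by
  classical
  intro z
  obtain ⟨s, hs, hsz⟩ := hr z
  obtain ⟨s', hs', hsz'⟩ := hr' z
  have ha := (r z).2
  have ha' := (r' z).2
  set a := (r z).1
  set a' := (r' z).1
  have h0X : (0 : Ambient d) ∈ interior (convexHull ℝ X) :=
    interior_mono (convexHull_mono sdiff_subset) h0
  lift X to Finset (Ambient d) using hXfin
  have hdiff : (X : Set (Ambient d)) \ {v} = (X.erase v : Finset (Ambient d)) := by simp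
  have hYS : (X.erase v : Set (Ambient d)) ⊆ UnitSphere d :=
    hdiff ▸ sdiff_subset.trans hXS
  have haX := realization_delaunay_subset _ ha
  have ha'Y := realization_delaunay_subset _ ha'
  have ha'X : a' ∈ weightsOn (X : Set (Ambient d)) :=
    ⟨ha'Y.1, ha'Y.2.1.trans sdiff_subset, ha'Y.2.2⟩
  have hs's : s' ≤ s := le_of_mem_realization_of_ray hXS h0X ha ha'X hs hsz hsz'
  have hcardX := card_of_zero_mem_interior_convexHull h0X
  have hface : IsSimplexOf L (g '' Function.support a) := by
    obtain ⟨σ, hσ, hσa⟩ := ha.2.1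
    rw [← hσa]
    exact hg σ hσ
  rcases hs's.eq_or_lt with heq | hlt
  -- If both hulls are left at the same point, the weights agree and g(σ) is already a simplex.
  · have haa : a = a' := eq_of_weightedPoint_eq hXS hXgen hcardX ha ha'X
      (by rw [hsz, hsz', heq])
    rwa [← haa, union_self]
  -- Otherwise a would be a convex combination of X \ {v} farther out on the ray than a'.
  have hva : v ∈ Function.support a := by
    by_contra hva
    rw [hdiff] at ha' h0
    refine absurd (le_of_mem_realization_of_ray hYS h0 ha' ⟨haX.1, fun x hx => ?_, haX.2.2⟩
      hs' hsz' hsz) (not_le.2 hlt)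
    rw [← hdiff]
    exact ⟨haX.2.1 hx, fun hxv => hva (mem_singleton_iff.1 hxv ▸ hx)⟩
  obtain ⟨c, hc, h, hle, hsupp⟩ :=
    exists_supporting_of_mem_realization (sdiff_subset.trans hXS) ha'
  have hpos := pos_of_zero_mem_interior_convexHull h0 hc hle
  -- Otherwise the hyperplane through r'(z) would support all of X, and r(z) could not be farther
  -- out.
  have hvh : h < inner ℝ c v := by
    by_contra hcon
    have hleX : ∀ x ∈ X, inner ℝ c x ≤ h := fun x hx => by
      by_cases hxv : x = v
      · rw [hxv]; exact not_lt.1 hcon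
      · exact hle x ⟨hx, hxv⟩
    have h1 := (inner_weightedPoint_eq_iff ha'X hleX).2 hsupp
    have h2 := inner_weightedPoint_le haX hleX
    rw [hsz', real_inner_smul_right] at h1
    rw [hsz, real_inner_smul_right, ← h1] at h2
    exact absurd (le_of_mul_le_mul_right h2 (pos_of_mul_pos_right (h1 ▸ hpos) hs'.le))
      (not_le.2 hlt)
  have hcardY : d + 2 ≤ (X.erase v).card :=
    card_of_zero_mem_interior_convexHull (by rwa [← hdiff])
  rw [Finset.card_erase_of_mem hv] at hcardY
  rw [← image_union]
  refine IsSimplexOf.mono hsc (image_mono ?_) (Nonempty.image g ⟨v, Or.inl hva⟩)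
  rintro w (hw | hw)
  · obtain ⟨σ, hσ, hσa⟩ := ha.2.1
    exact ⟨Finset.singleton_nonempty w, σ, ⟨hσ, hσa.ge hva⟩,
      Finset.singleton_subset_iff.2 (hσa.ge hw)⟩
  · exact mem_closedStar_of_visible X.finite_toSet hXS hXgen (by rwa [Set.ncard_coe_finset])
      (by rw [Set.ncard_coe_finset]; omega) hv (ha'Y.2.1 hw) hle (hsupp w hw) hvh

end Removal

theorem mainTheorem12 {d : ℕ} {W : Type*} (L : PreAbstractSimplicialComplex W)
    (hL : L.faces.Finite)
    (X : Set (Ambient d)) (hXfin : X.Finite) (hXS : X ⊆ UnitSphere d) (hXgen : IsGeneric X)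
    (g : Ambient d → W) (hg : IsSimplicialMap (delaunay X) L g)
    (v : Ambient d) (hv : v ∈ X) (hsc : SimplexCondition (delaunay X) L g v) :
    ∃ hg' : IsSimplicialMap (delaunay (X \ {v})) L g,
      (0 : Ambient d) ∈ interior (convexHull ℝ (X \ {v})) →
        ∃ (r : UnitSphere d ≃ₜ realization (delaunay X))
          (r' : UnitSphere d ≃ₜ realization (delaunay (X \ {v}))),
          IsRadialProjection (delaunay X) r ∧
          IsRadialProjection (delaunay (X \ {v})) r' ∧
          AreContiguous L r r' g g ∧
          ContinuousMap.Homotopic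
            ((realizationMap (delaunay_finite hXfin) hg).comp ⟨r, r.continuous⟩)
            ((realizationMap (delaunay_finite (hXfin.subset Set.sdiff_subset)) hg').comp
              ⟨r', r'.continuous⟩) := by
  refine ⟨isSimplicialMap_delaunay_diff_singleton hXfin hXS hXgen hg hv hsc, fun h0 => ?_⟩
  obtain ⟨r, hr⟩ := exists_isRadialProjection hXfin hXS hXgen
    (interior_mono (convexHull_mono sdiff_subset) h0)
  obtain ⟨r', hr'⟩ := exists_isRadialProjection (hXfin.subset sdiff_subset)
    (sdiff_subset.trans hXS) (hXgen.mono sdiff_subset) h0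
  have hcont := areContiguous_delaunay_diff_singleton hXfin hXS hXgen hg hv hsc h0 hr hr'
  refine ⟨r, r', hr, hr', hcont, homotopic_of_common_simplex _ _ fun z => ?_⟩
  have hsupp : ∀ {Y : Set (Ambient d)}, Y.Finite → ∀ a : realization (delaunay Y),
      Function.support (pushWeights g a.1) = g '' Function.support a.1 := fun hY a =>
    support_pushWeights g a.1 a.2.1 (hY.subset (realization_delaunay_subset _ a.2).2.1)
  -- The support of |g|(a) is the image under g of the support of a, so contiguity is exactly the
  -- common simplex condition.
  have hz := hcont z
  rw [← hsupp hXfin, ← hsupp (hXfin.subset sdiff_subset)] at hz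
  exact hz
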